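/- For integers $n\ge 0$ and $d\ge 3$ let $[2^n]^d=\{1,\dots,2^n\}^d\subset\mathbb Z^d$ be the $d$-dimensional grid, with edge set $E([2^n]^d)$ consisting of the unordered pairs $\{u,v\}\subseteq[2^n]^d$ such that $u=v\pm e_i$ for some standard basis vector $e_i$, $1\le i\le d$. For $A\subseteq[2^n]^d$ let $$\partial A=\{\{u,v\}\in E([2^n]^d): |\{u,v\}\cap A|=1\},\qquad \mathrm{Vol}(A)=\frac{|A|}{|[2^n]^d|}=2^{-nd}|A|,\qquad \mathrm{Per}(A)=\frac1d\,2^{-n(d-1)}\,|\partial A|.$$ **Theorem 4.2 (Isoperimetric inequalities).** There is a constant $C_{iso}\le 2$, independent of $n$ and $d$, such that for all integers $n\ge 0$, $d\ge 3$ and all $A\subseteq[2^n]^d$, $$\mathrm{Vol}(A)\le 2^{-2d}\implies \mathrm{Vol}(A)^{1-\frac1d}\le C_{iso}\,\mathrm{Per}(A),$$ and $$\mathrm{Vol}(A)\le \tfrac12\implies \mathrm{Vol}(A)^{1-\frac1d}\le C_{iso}\,d\cdot\mathrm{Per}(A).$$ -/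

import Mathlib

/-- The vertex set `[2^n]^d` of the grid: integer points all of whose coordinates
lie in `{1, …, 2^n}`. -/
noncomputable def gridPoints (n d : ℕ) : Finset (Fin d → ℤ) :=
  Fintype.piFinset fun _ => Finset.Icc 1 (2 ^ n)

/-- The edge set `E([2^n]^d)`: the unordered pairs `{u, v}` of grid points with
`u = v ± e_i` for some standard basis vector `e_i`. -/
noncomputable def gridEdges (n d : ℕ) : Finset (Sym2 (Fin d → ℤ)) :=
  ((gridPoints n d ×ˢ gridPoints n d).filter fun p =>
    ∃ i : Fin d, p.1 = p.2 + Pi.single i 1 ∨ p.1 = p.2 - Pi.single i 1).image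
      fun p => s(p.1, p.2)

/-- The edge boundary `∂A`: the edges `{u, v}` of the grid with `|{u, v} ∩ A| = 1`. -/
noncomputable def gridBoundary (n d : ℕ) (A : Finset (Fin d → ℤ)) : Finset (Sym2 (Fin d → ℤ)) :=
  (gridEdges n d).filter fun e => (e.toFinset ∩ A).card = 1

/-- `Vol(A) = |A| / |[2^n]^d|`. -/
noncomputable def gridVol (n d : ℕ) (A : Finset (Fin d → ℤ)) : ℝ :=
  (A.card : ℝ) / ((gridPoints n d).card : ℝ)

/-- `Per(A) = (1/d) 2^{-n(d-1)} |∂A|`, with the exponent `-n(d-1)` an integer. -/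
noncomputable def gridPer (n d : ℕ) (A : Finset (Fin d → ℤ)) : ℝ :=
  1 / (d : ℝ) * (2 : ℝ) ^ (-((n : ℤ) * ((d : ℤ) - 1))) * ((gridBoundary n d A).card : ℝ)

/-! Put N = 2^n and Vol(A) = r^d. By Loomis–Whitney (`card_pow_le_prod_card_coordProj`) and AM-GM,
the projections of A along the d axes have on average at least (rN)^(d-1) points, so at least
d(rN)^(d-1) axis-parallel lines meet A. In each direction at most |A|/N = r^d N^(d-1) lines lie
wholly in A, and each remaining line that meets A carries its own boundary edge
(`sum_card_coordProj_sdiff_le`).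

Subtracting gives Per(A) ≥ r^(d-1)(1 - r), which is `le_gridPer_of_gridVol_eq`. Both claims then
follow from a lower bound on 1 - r. -/

theorem le_rpow_inv_of_pow_le {k : ℕ} (hk : k ≠ 0) {x y : ℝ} (hx : 0 ≤ x) (h : x ^ k ≤ y) :
    x ≤ y ^ (k : ℝ)⁻¹ := by
  rw [← Real.pow_rpow_inv_natCast hx hk]
  exact Real.rpow_le_rpow (by positivity) h (by positivity)

/-- A discrete form of Hölder's inequality for several functions. -/
theorem sum_pow_le_mul_prod_sum {τ : Type*} (s : Finset τ) (k : ℕ) (hk : k ≠ 0) (c : ℝ)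
    (hc : 0 ≤ c) (x : τ → ℝ) (f : Fin k → τ → ℝ) (hx : ∀ t ∈ s, 0 ≤ x t)
    (hf : ∀ i, ∀ t ∈ s, 0 < f i t) (h : ∀ t ∈ s, x t ^ k ≤ c * ∏ i, f i t) :
    (∑ t ∈ s, x t) ^ k ≤ c * ∏ i, ∑ t ∈ s, f i t := by
  rcases s.eq_empty_or_nonempty with rfl | hs
  · simp only [Finset.sum_empty, zero_pow hk]
    positivity
  have hk' : (0 : ℝ) < k := by positivity
  have hS : ∀ i, 0 < ∑ t ∈ s, f i t := fun i => Finset.sum_pos (hf i) hs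
  set P := ∏ i, ∑ t ∈ s, f i t with hP
  have hP0 : 0 < P := Finset.prod_pos fun i _ => hS i
  -- Normalise each `f i` to have sum 1 and apply AM-GM pointwise; the arithmetic means then sum to
  -- 1 over `s`.
  have key : ∀ t ∈ s, x t ≤ (c * P) ^ (1 / (k : ℝ)) *
      (∑ i, 1 / (k : ℝ) * (f i t / ∑ u ∈ s, f i u)) := by
    intro t ht
    have h1 : x t ≤ (c * P * ∏ i, (f i t / ∑ u ∈ s, f i u)) ^ (1 / (k : ℝ)) := by
      rw [Finset.prod_div_distrib, ← hP, mul_assoc, mul_div_cancel₀ _ hP0.ne', one_div]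
      exact le_rpow_inv_of_pow_le hk (hx t ht) (h t ht)
    have h0 : ∀ i, 0 ≤ f i t / ∑ u ∈ s, f i u := fun i => div_nonneg (hf i t ht).le (hS i).le
    rw [Real.mul_rpow (by positivity) (Finset.prod_nonneg fun i _ => h0 i),
      ← Real.finsetProd_rpow _ _ fun i _ => h0 i] at h1
    refine h1.trans (mul_le_mul_of_nonneg_left ?_ (by positivity))
    refine Real.geom_mean_le_arith_mean_weighted _ _ _ (fun _ _ => by positivity) ?_
      fun i _ => h0 i
    simp [hk]
  have hsum : ∑ t ∈ s, x t ≤ (c * P) ^ (1 / (k : ℝ)) := by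
    refine (Finset.sum_le_sum key).trans ?_
    rw [← Finset.mul_sum, Finset.sum_comm]
    simp_rw [← Finset.mul_sum, ← Finset.sum_div]
    simp [fun i => div_self (hS i).ne', hk]
  calc (∑ t ∈ s, x t) ^ k ≤ ((c * P) ^ (1 / (k : ℝ))) ^ k :=
        pow_le_pow_left₀ (Finset.sum_nonneg hx) hsum k
    _ = c * P := by rw [one_div, Real.rpow_inv_natCast_pow (by positivity) hk]

/-- The projection of a finite set of integer points along the `i`-th coordinate axis. -/
def coordProj {d : ℕ} (i : Fin (d + 1)) (A : Finset (Fin (d + 1) → ℤ)) : Finset (Fin d → ℤ) :=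
  A.image i.removeNth

/-- The slice of a finite set of integer points where the first coordinate equals `t`. -/
def headSlice {d : ℕ} (A : Finset (Fin (d + 1) → ℤ)) (t : ℤ) : Finset (Fin d → ℤ) :=
  (A.filter fun x => x 0 = t).image Fin.tail

theorem mem_coordProj {d : ℕ} {i : Fin (d + 1)} {A : Finset (Fin (d + 1) → ℤ)}
    {y : Fin d → ℤ} : y ∈ coordProj i A ↔ ∃ t, (i.insertNth t y : Fin (d + 1) → ℤ) ∈ A := by
  simp only [coordProj, Finset.mem_image]
  constructor
  · rintro ⟨x, hx, rfl⟩
    exact ⟨x i, by simpa using hx⟩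
  · rintro ⟨t, ht⟩
    exact ⟨_, ht, by simp⟩

theorem mem_headSlice {d : ℕ} {A : Finset (Fin (d + 1) → ℤ)} {t : ℤ} {y : Fin d → ℤ} :
    y ∈ headSlice A t ↔ (Fin.cons t y : Fin (d + 1) → ℤ) ∈ A := by
  simp only [headSlice, Finset.mem_image, Finset.mem_filter]
  constructor
  · rintro ⟨x, ⟨hx, rfl⟩, rfl⟩
    simpa using hx
  · intro h
    exact ⟨_, ⟨h, by simp⟩, by simp⟩

theorem card_eq_sum_headSlice {d : ℕ} (A : Finset (Fin (d + 1) → ℤ)) :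
    A.card = ∑ t ∈ A.image (fun x => x 0), (headSlice A t).card := by
  rw [Finset.card_eq_sum_card_image (fun x => x 0) A]
  refine Finset.sum_congr rfl fun t _ => (Finset.card_image_of_injOn ?_).symm
  intro x hx y hy hxy
  simp only [Finset.coe_filter, Set.mem_ofPred_eq] at hx hy
  rw [← Fin.cons_self_tail x, ← Fin.cons_self_tail y, hxy, hx.2, hy.2]

theorem headSlice_coordProj_succ {d : ℕ} (A : Finset (Fin (d + 2) → ℤ)) (i : Fin (d + 1))
    (t : ℤ) : headSlice (coordProj i.succ A) t = coordProj i (headSlice A t) := by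
  ext y
  simp only [mem_headSlice, mem_coordProj, Fin.insertNth_succ_cons]

/-- Projecting along a later axis keeps the first coordinate, so it respects the slicing. -/
theorem sum_card_coordProj_headSlice {d : ℕ} (A : Finset (Fin (d + 2) → ℤ))
    (i : Fin (d + 1)) :
    ∑ t ∈ A.image (fun x => x 0), (coordProj i (headSlice A t)).card =
      (coordProj i.succ A).card := by
  rw [card_eq_sum_headSlice (coordProj i.succ A)]
  have : (coordProj i.succ A).image (fun x => x 0) = A.image (fun x => x 0) := by
    rw [coordProj, Finset.image_image]
    rfl
  simp only [this, headSlice_coordProj_succ]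

/-- The **Loomis–Whitney inequality** for finite sets of integer points. -/
theorem card_pow_le_prod_card_coordProj {d : ℕ} (A : Finset (Fin (d + 1) → ℤ))
    (hA : A.Nonempty) : (A.card : ℝ) ^ d ≤ ∏ i, ((coordProj i A).card : ℝ) := by
  induction d with
  | zero =>
    have h : (coordProj 0 A).Nonempty := hA.image _
    simpa using h.card_pos
  | succ d ih =>
    have hne : ∀ t ∈ A.image (fun x => x 0), (headSlice A t).Nonempty := by
      intro t ht
      obtain ⟨x, hx, rfl⟩ := Finset.mem_image.1 ht
      exact ⟨Fin.tail x, mem_headSlice.2 (by simpa using hx)⟩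
    rw [Fin.prod_univ_succ, card_eq_sum_headSlice A]
    simp_rw [← sum_card_coordProj_headSlice]
    push_cast
    -- Of the d + 1 factors |A_t|, one is at most the projection along the first axis, which
    -- contains every slice; the other d are bounded by induction.
    refine sum_pow_le_mul_prod_sum _ _ d.succ_ne_zero _ (by positivity) _
      (fun i t => ((coordProj i (headSlice A t)).card : ℝ)) (fun _ _ => by positivity) ?_ ?_
    · intro i t ht
      exact_mod_cast ((hne t ht).image _).card_pos
    · intro t ht
      rw [pow_succ']
      refine mul_le_mul ?_ (ih _ (hne t ht)) (by positivity) (by positivity)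
      refine Nat.cast_le.2 (Finset.card_le_card fun y hy => ?_)
      exact mem_coordProj.2 ⟨t, by simpa using mem_headSlice.1 hy⟩

/-- The base points of the axis-parallel lines in direction `i` all of whose grid points
belong to `A`. -/
noncomputable def fullLines (n : ℕ) {d : ℕ} (i : Fin (d + 1)) (A : Finset (Fin (d + 1) → ℤ)) :
    Finset (Fin d → ℤ) :=
  (coordProj i A).filter fun y =>
    (Finset.Icc (1 : ℤ) (2 ^ n)).image (fun t => (i.insertNth t y : Fin (d + 1) → ℤ)) ⊆ A

theorem mem_fullLines {n d : ℕ} {i : Fin (d + 1)} {A : Finset (Fin (d + 1) → ℤ)}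
    {y : Fin d → ℤ} : y ∈ fullLines n i A ↔ y ∈ coordProj i A ∧
      ∀ t ∈ Finset.Icc (1 : ℤ) (2 ^ n), (i.insertNth t y : Fin (d + 1) → ℤ) ∈ A := by
  rw [fullLines, Finset.mem_filter, Finset.image_subset_iff]

theorem fullLines_subset {n d : ℕ} {i : Fin (d + 1)} {A : Finset (Fin (d + 1) → ℤ)} :
    fullLines n i A ⊆ coordProj i A :=
  Finset.filter_subset _ _

theorem card_Icc_one_two_pow (n : ℕ) : (Finset.Icc (1 : ℤ) (2 ^ n)).card = 2 ^ n := by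
  rw [Int.card_Icc, add_sub_cancel_right]
  exact Int.toNat_natCast (2 ^ n)

/-- Parallel lines are disjoint, and each full one contributes 2^n points to `A`. -/
theorem card_fullLines_mul_le (n : ℕ) {d : ℕ} (i : Fin (d + 1))
    (A : Finset (Fin (d + 1) → ℤ)) : (fullLines n i A).card * 2 ^ n ≤ A.card := by
  rw [← card_Icc_one_two_pow, ← Finset.card_product]
  refine Finset.card_le_card_of_injOn (fun p => (i.insertNth p.2 p.1 : Fin (d + 1) → ℤ)) ?_ ?_
  · rintro ⟨y, t⟩ hp
    have hp := Finset.mem_product.1 hp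
    exact (mem_fullLines.1 hp.1).2 t hp.2
  · rintro ⟨y, t⟩ - ⟨y', t'⟩ - h
    obtain ⟨h1, h2⟩ := Fin.insertNth_inj.1 h
    exact Prod.ext h2 h1

theorem insertNth_mem_gridPoints {n d : ℕ} {i : Fin (d + 1)} {t : ℤ} {y : Fin d → ℤ} :
    (i.insertNth t y : Fin (d + 1) → ℤ) ∈ gridPoints n (d + 1) ↔
      t ∈ Finset.Icc (1 : ℤ) (2 ^ n) ∧ y ∈ gridPoints n d := by
  simp only [gridPoints, Fintype.mem_piFinset, Fin.forall_iff_succAbove i,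
    Fin.insertNth_apply_same, Fin.insertNth_apply_succAbove]

theorem insertNth_add_one {d : ℕ} (i : Fin (d + 1)) (t : ℤ) (y : Fin d → ℤ) :
    (i.insertNth (t + 1) y : Fin (d + 1) → ℤ) = i.insertNth t y + Pi.single i 1 := by
  funext j
  rcases Fin.eq_self_or_eq_succAbove i j with rfl | ⟨j, rfl⟩ <;> simp

/-- A predicate on an integer interval that is neither always true nor always false switches
between two consecutive integers. -/
theorem exists_switch {P : ℤ → Prop} {N a b : ℤ} (ha : a ∈ Finset.Icc 1 N)
    (hb : b ∈ Finset.Icc 1 N) (hPa : P a) (hPb : ¬ P b) :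
    ∃ t, 1 ≤ t ∧ t + 1 ≤ N ∧ (P t ↔ ¬ P (t + 1)) := by
  by_contra! hcon
  rw [Finset.mem_Icc] at ha hb
  have hstep : ∀ t, 1 ≤ t → t ≤ N → (P t ↔ P 1) := by
    intro t ht
    induction t, ht using Int.leInduction with
    | base => simp
    | succ t ht ih =>
      intro h
      have h1 := ih (by omega)
      have h2 := hcon t ht h
      tauto
  exact hPb ((hstep b hb.1 hb.2).2 ((hstep a ha.1 ha.2).1 hPa))

theorem mk_mem_gridBoundary {n d : ℕ} {A : Finset (Fin d → ℤ)} {u : Fin d → ℤ} {i : Fin d}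
    (hu : u ∈ gridPoints n d) (hv : u + Pi.single i 1 ∈ gridPoints n d)
    (h : u ∈ A ↔ u + Pi.single i 1 ∉ A) : s(u, u + Pi.single i 1) ∈ gridBoundary n d A := by
  rw [gridBoundary, Finset.mem_filter]
  constructor
  · refine Finset.mem_image.2 ⟨(u, u + Pi.single i 1), ?_, rfl⟩
    simp only [Finset.mem_filter, Finset.mem_product]
    exact ⟨⟨hu, hv⟩, i, Or.inr (by simp)⟩
  · rw [Finset.card_eq_one]
    by_cases hA : u ∈ A
    · refine ⟨u, ?_⟩
      ext w
      simp only [Finset.mem_inter, Sym2.mem_toFinset, Sym2.mem_iff, Finset.mem_singleton]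
      grind
    · refine ⟨u + Pi.single i 1, ?_⟩
      ext w
      simp only [Finset.mem_inter, Sym2.mem_toFinset, Sym2.mem_iff, Finset.mem_singleton]
      grind

/-- Matching the endpoints crosswise would force a basis vector to have a negative coordinate. Hence
edges chosen on different lines are distinct. -/
theorem mk_add_single_inj {d : ℕ} {u v : Fin d → ℤ} {i j : Fin d}
    (h : s(u, u + Pi.single i 1) = s(v, v + Pi.single j 1)) : u = v ∧ i = j := by
  rcases Sym2.eq_iff.1 h with ⟨rfl, h2⟩ | ⟨h1, h2⟩
  · refine ⟨rfl, ?_⟩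
    have h3 := congrFun (add_left_cancel h2) i
    by_contra hij
    simp [hij] at h3
  · exfalso
    have h3 := congrFun h1 i
    have h4 := congrFun h2 i
    have h5 : (0 : ℤ) ≤ (Pi.single j 1 : Fin d → ℤ) i := by
      rw [Pi.single_apply]
      split_ifs <;> simp
    simp only [Pi.add_apply, Pi.single_eq_same] at h3 h4
    omega

/-- Every line that meets `A` without being contained in `A` carries a boundary edge. -/
theorem sum_card_coordProj_sdiff_le {n d : ℕ} {A : Finset (Fin (d + 1) → ℤ)}
    (hA : A ⊆ gridPoints n (d + 1)) :
    ∑ i, (coordProj i A \ fullLines n i A).card ≤ (gridBoundary n (d + 1) A).card := by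
  have hex : ∀ i : Fin (d + 1), ∀ y ∈ coordProj i A \ fullLines n i A, ∃ t : ℤ,
      s((i.insertNth t y : Fin (d + 1) → ℤ), i.insertNth t y + Pi.single i 1) ∈
        gridBoundary n (d + 1) A := by
    intro i y hy
    rw [Finset.mem_sdiff] at hy
    obtain ⟨a, ha⟩ := mem_coordProj.1 hy.1
    have hgrid := insertNth_mem_gridPoints.1 (hA ha)
    have hb : ∃ b ∈ Finset.Icc (1 : ℤ) (2 ^ n), (i.insertNth b y : Fin (d + 1) → ℤ) ∉ A := by
      by_contra! hcon
      exact hy.2 (mem_fullLines.2 ⟨hy.1, hcon⟩)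
    obtain ⟨b, hb, hbA⟩ := hb
    obtain ⟨t, ht1, ht2, ht⟩ :=
      exists_switch (P := fun t => (i.insertNth t y : Fin (d + 1) → ℤ) ∈ A) hgrid.1 hb ha hbA
    simp only [insertNth_add_one] at ht
    refine ⟨t, mk_mem_gridBoundary ?_ ?_ ht⟩
    · exact insertNth_mem_gridPoints.2 ⟨Finset.mem_Icc.2 ⟨ht1, by omega⟩, hgrid.2⟩
    · rw [← insertNth_add_one]
      exact insertNth_mem_gridPoints.2 ⟨Finset.mem_Icc.2 ⟨by omega, ht2⟩, hgrid.2⟩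
  choose! T hT using hex
  rw [← Finset.card_sigma]
  refine Finset.card_le_card_of_injOn
    (fun p => s((p.1.insertNth (T p.1 p.2) p.2 : Fin (d + 1) → ℤ),
      p.1.insertNth (T p.1 p.2) p.2 + Pi.single p.1 1)) ?_ ?_
  · rintro ⟨i, y⟩ hp
    exact hT i y (Finset.mem_sigma.1 hp).2
  · rintro ⟨i, y⟩ - ⟨j, z⟩ - h
    obtain ⟨h1, h2⟩ := mk_add_single_inj h
    dsimp only at h1 h2
    subst h2
    rw [(Fin.insertNth_inj.1 h1).2]

theorem card_gridPoints (n d : ℕ) : (gridPoints n d).card = (2 ^ n) ^ d := by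
  rw [gridPoints, Fintype.card_piFinset_const, card_Icc_one_two_pow]

/-- The isoperimetric inequality `Per(A) ≥ r^(d-1) (1 - r)`, where `Vol(A) = r^d`. -/
theorem le_gridPer_of_gridVol_eq {n d : ℕ} {A : Finset (Fin (d + 1) → ℤ)}
    (hd : d ≠ 0) (hA : A ⊆ gridPoints n (d + 1)) {r : ℝ} (hr : 0 ≤ r)
    (hvol : gridVol n (d + 1) A = r ^ (d + 1)) :
    r ^ d * (1 - r) ≤ gridPer n (d + 1) A := by
  have hN : (0 : ℝ) < 2 ^ n := by positivity
  have hcard : (A.card : ℝ) = (r * 2 ^ n) ^ (d + 1) := by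
    rw [gridVol, card_gridPoints, div_eq_iff (by positivity)] at hvol
    rw [hvol, mul_pow]
    push_cast
    ring
  rcases A.eq_empty_or_nonempty with rfl | hne
  · have hr0 : r = 0 := by
      by_contra h
      have : 0 < (r * 2 ^ n) ^ (d + 1) := by positivity
      simp only [Finset.card_empty, Nat.cast_zero] at hcard
      linarith
    have : gridPer n (d + 1) ∅ = 0 := by simp [gridPer, gridBoundary]
    simp [this, hr0, hd]
  set m : Fin (d + 1) → ℝ := fun i => ((coordProj i A).card : ℝ) with hm
  have hm0 : ∀ i, 0 ≤ m i := fun i => by positivity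
  have hamgm : (d + 1 : ℝ) * (r * 2 ^ n) ^ d ≤ ∑ i, m i := by
    have hLW := card_pow_le_prod_card_coordProj A hne
    rw [hcard, ← pow_mul, mul_comm (d + 1), pow_mul] at hLW
    have h1 : (r * 2 ^ n) ^ d ≤ (∏ i, m i) ^ (((d + 1 : ℕ) : ℝ)⁻¹) :=
      le_rpow_inv_of_pow_le d.succ_ne_zero (by positivity) hLW
    have h2 := Real.geom_mean_le_arith_mean_weighted Finset.univ
      (fun _ => (((d + 1 : ℕ) : ℝ)⁻¹)) m (fun _ _ => by positivity) (by simp; field_simp)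
      fun i _ => hm0 i
    rw [Real.finsetProd_rpow _ _ fun i _ => hm0 i, ← Finset.mul_sum] at h2
    have h3 := h1.trans h2
    rw [← div_eq_inv_mul, le_div_iff₀' (by positivity)] at h3
    exact_mod_cast h3
  have hlines : ∑ i, m i - (d + 1) * (r ^ (d + 1) * (2 ^ n) ^ d) ≤
      ((gridBoundary n (d + 1) A).card : ℝ) := by
    have h1 : (∑ i, ((coordProj i A \ fullLines n i A).card : ℝ)) ≤
        ((gridBoundary n (d + 1) A).card : ℝ) := by
      exact_mod_cast sum_card_coordProj_sdiff_le hA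
    refine le_trans ?_ h1
    have h2 : ∀ i, m i - r ^ (d + 1) * (2 ^ n) ^ d ≤
        ((coordProj i A \ fullLines n i A).card : ℝ) := by
      intro i
      rw [Finset.cast_card_sdiff fullLines_subset]
      have h3 : ((fullLines n i A).card : ℝ) * 2 ^ n ≤ A.card := by
        exact_mod_cast card_fullLines_mul_le n i A
      rw [hcard, mul_pow, pow_succ (2 ^ n : ℝ), ← mul_assoc] at h3
      have := le_of_mul_le_mul_right h3 hN
      simp only [hm]
      linarith
    calc _ = ∑ i, (m i - r ^ (d + 1) * (2 ^ n) ^ d) := by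
          simp [Finset.sum_sub_distrib]
      _ ≤ _ := Finset.sum_le_sum fun i _ => h2 i
  have hexp : (2 : ℝ) ^ (-((n : ℤ) * (((d + 1 : ℕ) : ℤ) - 1))) = ((2 ^ n) ^ d)⁻¹ := by
    rw [← pow_mul, zpow_neg]
    congr 1
    rw [← zpow_natCast]
    congr 1
    push_cast
    ring
  have hper : gridPer n (d + 1) A =
      ((gridBoundary n (d + 1) A).card : ℝ) / ((d + 1) * (2 ^ n) ^ d) := by
    rw [gridPer, hexp]
    push_cast
    field_simp
  rw [hper, le_div_iff₀ (by positivity)]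
  calc r ^ d * (1 - r) * ((d + 1) * (2 ^ n) ^ d)
      = (d + 1) * (r * 2 ^ n) ^ d - (d + 1) * (r ^ (d + 1) * (2 ^ n) ^ d) := by
        rw [mul_pow]
        ring
    _ ≤ _ := by linarith

theorem theorem4p2 :
    ∃ C : ℝ, C ≤ 2 ∧
      ∀ (n d : ℕ), 3 ≤ d → ∀ A : Finset (Fin d → ℤ), A ⊆ gridPoints n d →
        (gridVol n d A ≤ (2 : ℝ) ^ (-(2 * (d : ℤ))) →
          gridVol n d A ^ (1 - 1 / (d : ℝ)) ≤ C * gridPer n d A) ∧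
        (gridVol n d A ≤ 1 / 2 →
          gridVol n d A ^ (1 - 1 / (d : ℝ)) ≤ C * (d : ℝ) * gridPer n d A) := by
  refine ⟨2, le_rfl, fun n d hd A hA => ?_⟩
  obtain ⟨d, rfl⟩ : ∃ k, d = k + 1 := ⟨d - 1, by omega⟩
  have hv0 : 0 ≤ gridVol n (d + 1) A := by
    unfold gridVol
    positivity
  set v := gridVol n (d + 1) A with hv
  set r : ℝ := v ^ (((d + 1 : ℕ) : ℝ)⁻¹) with hr
  have hr0 : 0 ≤ r := by positivity
  have hrv : v = r ^ (d + 1) := (Real.rpow_inv_natCast_pow hv0 d.succ_ne_zero).symm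
  have hpow : v ^ (1 - 1 / ((d + 1 : ℕ) : ℝ)) = r ^ d := by
    rw [hr, ← Real.rpow_natCast, ← Real.rpow_mul hv0]
    congr 1
    push_cast
    field_simp
    ring
  have hper : r ^ d * (1 - r) ≤ gridPer n (d + 1) A := 
    le_gridPer_of_gridVol_eq (by omega) hA hr0 hrv
  have hrd : 0 ≤ r ^ d := by positivity
  rw [hpow]
  constructor
  · intro h
    -- The threshold is (1/4)^(d+1), and r ≤ 1/4 makes 2(1 - r) at least 1.
    have h4 : r ≤ 1 / 4 := by
      refine le_of_pow_le_pow_left₀ d.succ_ne_zero (by norm_num) ?_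
      rw [← hrv]
      refine h.trans (le_of_eq ?_)
      rw [neg_mul_eq_neg_mul, zpow_mul, zpow_natCast]
      norm_num
    nlinarith
  · intro h
    -- With D = d + 1, Bernoulli's inequality gives (1 - 1/(2D))^D ≥ 1/2 ≥ r^D.
    have h2 : r ≤ 1 - 1 / (2 * ((d + 1 : ℕ) : ℝ)) := by
      have hle : 1 / (2 * ((d + 1 : ℕ) : ℝ)) ≤ 1 := by
        rw [div_le_one (by positivity)]
        push_cast
        linarith [(Nat.cast_nonneg d : (0 : ℝ) ≤ d)]
      refine le_of_pow_le_pow_left₀ d.succ_ne_zero (by linarith) ?_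
      rw [← hrv]
      have hb := one_add_mul_le_pow (a := -(1 / (2 * ((d + 1 : ℕ) : ℝ)))) (by linarith) (d + 1)
      have he : 1 + ((d + 1 : ℕ) : ℝ) * -(1 / (2 * ((d + 1 : ℕ) : ℝ))) = 1 / 2 := by
        field_simp
        norm_num
      rw [he, ← sub_eq_add_neg] at hb
      exact h.trans hb
    have h3 : 1 ≤ 2 * ((d + 1 : ℕ) : ℝ) * (1 - r) := by
      have : 1 / (2 * ((d + 1 : ℕ) : ℝ)) ≤ 1 - r := by linarith
      rwa [div_le_iff₀' (by positivity)] at this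
    calc r ^ d = r ^ d * 1 := (mul_one _).symm
      _ ≤ r ^ d * (2 * ((d + 1 : ℕ) : ℝ) * (1 - r)) := mul_le_mul_of_nonneg_left h3 hrd
      _ = 2 * ((d + 1 : ℕ) : ℝ) * (r ^ d * (1 - r)) := by ring
      _ ≤ _ := mul_le_mul_of_nonneg_left hper (by positivity)
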